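/- **Conventions.** For a real random variable $\xi$ with law $\mu$ put $T_\xi(x)=\mathbf P(|\xi|\ge x)$ and $\psi(t)=1-\operatorname{Re}\mathbf E e^{it\xi}$. A *natural norming sequence* of $\xi$ is a sequence $b(n)$, $n\ge1$, of positive numbers with $b(1)=1$, $b(n)\to\infty$, and $\psi(1/b(n))=1/n$ for every $n\ge 2$ for which the equation $\psi(s)=1/n$ has a positive solution $s$ (for the finitely many other $n$, $b(n)>0$ is arbitrary). For independent copies $\xi(1),\xi(2),\dots$ of $\xi$ let $S(n)=b(n)^{-1}\sum_{k=1}^n\xi(k)$ and $U(x)=\sup_{n\ge1}T_{S(n)}(x)$. The law of $\xi$ is in $RT$ if there is $c>0$ with $T_\xi(2/a)\ge c\,a^{-1}\int_{-a}^a\psi(t)\,dt$ for all sufficiently small $a>0$. It is in $MI$ if there is $\Delta>0$ such that for each $t\in[0,\Delta)$ the quotient $\psi(\lambda t)/\psi(\lambda)$ is non-increasing in $\lambda\in(0,1)$ (it increases as $\lambda\downarrow0$). **Theorem 2.4.** Let $r\in(0,2)$. (i) Let $L$ be positive and continuous on $(1,\infty)$ and slowly varying at infinity. There is a constant $C_1=C_1(r,L)>0$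 such that the following holds for every $\gamma\in\mathbb R$ and every symmetric random variable $\xi$ with $$T_\xi(x)=x^{-r}(\log x)^\gamma L(\log x),\qquad x>e,$$ whose law is in $RT\cap MI$, and for every natural norming sequence $b$ of $\xi$: there are $C'>0$ and $x_0>1$ (which may depend on the law of $\xi$ and on $b$) such that for all $x>x_0$ $$U(x)\le C'x^{-r},\qquad T_{S(n)}(x)\le C_1x^{-r}\ \text{ for every } n \text{ with } b(n)\ge1 ;$$ in particular $U(x)\le C_1(r,L)\,x^{-r}$ for all $x>x_0$ if $b(n)\ge1$ for all $n$. (ii) The rate $x^{-r}$ is exact for the symmetric stable law with $\mathbf Ee^{it\xi}=e^{-|t|^r}$: there are $c,C>0$ and $x_0>1$, depending only on $r$, such that $c\,x^{-r}\le U(x)\le C\,x^{-r}$ for all $x>x_0$. -/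

import Mathlib

open MeasureTheory ProbabilityTheory Filter Topology

noncomputable section

/-- Tail function of a law on the real line: `T(x) = P(|ξ| ≥ x)`. -/
def tail (μ : Measure ℝ) (x : ℝ) : ℝ := μ.real {y | x ≤ |y|}

/-- `ψ(t) = 1 - Re φ(t)`, where `φ` is the characteristic function of the law `μ`. -/
def psi (μ : Measure ℝ) (t : ℝ) : ℝ := 1 - (charFun μ t).re

/-- The law of `-ξ` is the law of `ξ`. -/
def SymmetricLaw (μ : Measure ℝ) : Prop := μ.map (fun y => -y) = μ

/-- `L` is positive, continuous (on the half-line where it is evaluated) and slowly varying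
at infinity. -/
structure IsSlowlyVarying (L : ℝ → ℝ) : Prop where
  continuousOn : ContinuousOn L (Set.Ioi 1)
  pos : ∀ y, 1 < y → 0 < L y
  tendsto_ratio : ∀ c, 0 < c → Tendsto (fun y => L (c * y) / L y) atTop (𝓝 1)

/-- `T(x) = x^{-r} (log x)^γ L(log x)` for all `x > e`. -/
def HasLogTail (μ : Measure ℝ) (r γ : ℝ) (L : ℝ → ℝ) : Prop :=
  ∀ x, Real.exp 1 < x → tail μ x = x ^ (-r) * Real.log x ^ γ * L (Real.log x)

/-- The class `RT` (regular tail): `T(2/a) ≥ C a⁻¹ ∫_{-a}^{a} ψ(t) dt` for some constant `C > 0`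
and all sufficiently small `a > 0`. -/
def ClassRT (μ : Measure ℝ) : Prop :=
  ∃ C, 0 < C ∧ ∀ᶠ a in 𝓝[>] (0 : ℝ), C * (a⁻¹ * ∫ t in (-a)..a, psi μ t) ≤ tail μ (2 / a)

/-- The class `MI`: for all `t` in some `[0, Δ)` the quotient `ψ(λ t) / ψ(λ)` increases
(in the weak sense) as `λ ∈ (0, 1)` decreases to `0`. -/
def ClassMI (μ : Measure ℝ) : Prop :=
  ∃ Δ, 0 < Δ ∧ ∀ t ∈ Set.Ico 0 Δ,
    AntitoneOn (fun l => psi μ (l * t) / psi μ l) (Set.Ioo 0 1)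

/-- `b` is a natural norming sequence for the law `μ`: `b(1) = 1`, and for `n ≥ 2` the number `b(n)`
is a positive solution of `ψ(1 / b(n)) = 1 / n`, on a branch with `b(n) → ∞`.
For the finitely many `n` for which the equation has no positive solution at all,
`b(n)` may be any positive number. -/
structure IsNaturalNorming (μ : Measure ℝ) (b : ℕ → ℝ) : Prop where
  one : b 1 = 1
  pos : ∀ n, 2 ≤ n → 0 < b n
  eqn : ∀ n : ℕ, 2 ≤ n → (∃ s, 0 < s ∧ psi μ s = 1 / (n : ℝ)) → psi μ (1 / b n) = 1 / (n : ℝ)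
  tendsto : Tendsto b atTop atTop

/-- The normed sum `S(n)` of the first `n` members of the sequence `ξ 0, ξ 1, …`. -/
def normedSum {Ω : Type*} (ξ : ℕ → Ω → ℝ) (b : ℕ → ℝ) (n : ℕ) (ω : Ω) : ℝ :=
  (b n)⁻¹ * ∑ k ∈ Finset.range n, ξ k ω

/-- The uniform tail function `U(x) = sup_{n ≥ 1} P(|S(n)| ≥ x)`. -/
def uniformTail {Ω : Type*} [MeasurableSpace Ω] (P : Measure Ω) (ξ : ℕ → Ω → ℝ) (b : ℕ → ℝ)
    (x : ℝ) : ℝ :=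
  ⨆ n : ℕ+, tail (P.map (normedSum ξ b n)) x

/-- `ξ 0, ξ 1, …` are independent random variables with common law `μ`. -/
structure IsIIDSequence {Ω : Type*} [MeasurableSpace Ω] (P : Measure Ω) (ξ : ℕ → Ω → ℝ)
    (μ : Measure ℝ) : Prop where
  indep : iIndepFun ξ P
  law : ∀ k, HasLaw (ξ k) μ P

/-- The symmetric stable law `St(r)`: characteristic function `exp(-|t|^r)`. -/
def IsSymmetricStable (μ : Measure ℝ) (r : ℝ) : Prop :=
  ∀ t, charFun μ t = ((Real.exp (-(|t| ^ r)) : ℝ) : ℂ)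

end

/-! ### Estimates for `psi` and the truncation inequalities. -/

section Psi

variable {μ : Measure ℝ}

/-! The upper bound rests on `ψ(lt) ≤ |t|^r ψ(l)` for all `l ∈ (0,1]` and small `t`
(`HasLogTail.exists_psi_mul_le`). By `MI`, a quotient `q = ψ(lt)/ψ(l)` above `t^r` would persist at
all smaller scales. Then `ψ` decays like a power `p < r` along `l t^k`, and by truncation so does
the tail, whereas `x^p T(x) → 0`. At `l = 1/b(n)` this gives `n ψ(t/b(n)) ≤ 2|t|^r`. Since `|1 -
φ^n| ≤ n|1 - φ|`, the truncation inequality turns it into a tail bound whose constant depends on `r`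
alone; the law enters only through the range of `t`. For the stable law `ψ` is explicit, and the
lower bound comes from `S(1) = ξ`. -/

theorem integrable_one_sub_cos [IsProbabilityMeasure μ] (t : ℝ) : Integrable (fun x => 1 - Real.cos (t * x)) μ := by
  refine (integrable_const (1 : ℝ)).sub ?_
  refine Integrable.of_bound (by fun_prop) 1 (ae_of_all _ fun x => ?_)
  simpa using Real.abs_cos_le_one (t * x)

theorem psi_eq_integral [IsProbabilityMeasure μ] (t : ℝ) : psi μ t = ∫ x, (1 - Real.cos (t * x)) ∂μ := by
  have hc : Integrable (fun x => Real.cos (t * x)) μ :=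
    Integrable.of_bound (by fun_prop) 1
      (ae_of_all _ fun x => by simpa using Real.abs_cos_le_one (t * x))
  have hi : Integrable (fun x : ℝ => Complex.exp (t * x * Complex.I)) μ :=
    Integrable.of_bound (by fun_prop) 1 (ae_of_all _ fun x => by
      rw [← Complex.ofReal_mul, Complex.norm_exp_ofReal_mul_I])
  rw [integral_sub (integrable_const _) hc, psi, charFun_apply_real]
  have h : ∫ x : ℝ, (Complex.exp (t * x * Complex.I)).re ∂μ = _ :=
    Complex.reCLM.integral_comp_comm hi
  rw [Complex.reCLM_apply] at h
  simp only [integral_const, probReal_univ, smul_eq_mul, mul_one]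
  rw [← h]
  congr 2 with x
  rw [← Complex.ofReal_mul, Complex.exp_ofReal_mul_I_re]

theorem psi_nonneg [IsProbabilityMeasure μ] (t : ℝ) : 0 ≤ psi μ t := by
  rw [psi_eq_integral]
  exact integral_nonneg fun x => sub_nonneg.2 (Real.cos_le_one _)

theorem psi_le_two [IsProbabilityMeasure μ] (t : ℝ) : psi μ t ≤ 2 := by
  have h := (Complex.abs_re_le_norm _).trans (norm_charFun_le_one (μ := μ) (t := t))
  have := (abs_le.1 h).1
  unfold psi; linarith

theorem psi_zero [IsProbabilityMeasure μ] : psi μ 0 = 0 := by simp [psi]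

theorem psi_neg (t : ℝ) : psi μ (-t) = psi μ t := by simp [psi, charFun_neg]

theorem psi_abs [IsProbabilityMeasure μ] (t : ℝ) : psi μ |t| = psi μ t := by
  rcases abs_choice t with h | h <;> rw [h]
  exact psi_neg t

theorem continuous_psi [IsProbabilityMeasure μ] : Continuous (psi μ) := by
  unfold psi
  exact continuous_const.sub (Complex.continuous_re.comp continuous_charFun)

theorem tail_nonneg (x : ℝ) : 0 ≤ tail μ x := measureReal_nonneg

theorem measurableSet_le_abs (x : ℝ) : MeasurableSet {y : ℝ | x ≤ |y|} :=
  measurableSet_le measurable_const measurable_id.abs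

/-- A truncation bound for `ψ` in terms of the value at another point and the tail. -/
theorem psi_le_mul_psi_add_tail [IsProbabilityMeasure μ] (t : ℝ) {B : ℝ} (hB : 0 < B) :
    psi μ t ≤ Real.pi ^ 2 / 4 * (t * B) ^ 2 * psi μ (1 / B) + 2 * tail μ B := by
  have hind : Integrable (({y : ℝ | B ≤ |y|}).indicator fun _ => (1 : ℝ)) μ :=
    (integrable_const _).indicator (measurableSet_le_abs B)
  have ht : tail μ B = ∫ x, ({y : ℝ | B ≤ |y|}).indicator (fun _ => (1 : ℝ)) x ∂μ := by
    rw [integral_indicator_const _ (measurableSet_le_abs B)]; simp [tail]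
  rw [psi_eq_integral t, psi_eq_integral (1 / B), ht, ← integral_const_mul, ← integral_const_mul,
    ← integral_add ((integrable_one_sub_cos _).const_mul _) (hind.const_mul _)]
  refine integral_mono (integrable_one_sub_cos t)
    (((integrable_one_sub_cos _).const_mul _).add (hind.const_mul _)) fun x => ?_
  have hpi : 0 < Real.pi := Real.pi_pos
  by_cases hx : B ≤ |x|
  · have h1 : ({y : ℝ | B ≤ |y|}).indicator (fun _ => (1 : ℝ)) x = 1 :=
      Set.indicator_of_mem (s := {y : ℝ | B ≤ |y|}) hx _
    have h2 := Real.neg_one_le_cos (t * x)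
    have h3 : 0 ≤ Real.pi ^ 2 / 4 * (t * B) ^ 2 * (1 - Real.cos (1 / B * x)) :=
      mul_nonneg (by positivity) (sub_nonneg.2 (Real.cos_le_one _))
    simp only [h1]; linarith
  · have h1 : ({y : ℝ | B ≤ |y|}).indicator (fun _ => (1 : ℝ)) x = 0 :=
      Set.indicator_of_notMem (s := {y : ℝ | B ≤ |y|}) hx _
    have hxB : |1 / B * x| ≤ Real.pi := by
      rw [abs_mul, abs_of_pos (by positivity : 0 < 1 / B), one_div_mul_eq_div]
      refine ((div_le_one hB).2 (not_le.1 hx).le).trans ?_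
      linarith [Real.pi_gt_three]
    -- On `|y| ≤ π`, `2y²/π² ≤ 1 - cos y ≤ y²/2`; the ratio of the two constants is `π²/4`.
    have h2 := Real.cos_le_one_sub_mul_cos_sq hxB
    have h3 := Real.one_sub_sq_div_two_le_cos (x := t * x)
    have h4 : Real.pi ^ 2 / 4 * (t * B) ^ 2 * (2 / Real.pi ^ 2 * (1 / B * x) ^ 2)
        = (t * x) ^ 2 / 2 := by
      field_simp; ring
    have h5 : Real.pi ^ 2 / 4 * (t * B) ^ 2 * (2 / Real.pi ^ 2 * (1 / B * x) ^ 2)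
        ≤ Real.pi ^ 2 / 4 * (t * B) ^ 2 * (1 - Real.cos (1 / B * x)) :=
      mul_le_mul_of_nonneg_left (by linarith) (by positivity)
    simp only [h1]; linarith

theorem charFun_eq_one_sub_psi (hμ : SymmetricLaw μ) (t : ℝ) :
    charFun μ t = ((1 - psi μ t : ℝ) : ℂ) := by
  have h1 : charFun μ (-t) = charFun μ t := by
    have h := charFun_map_mul (μ := μ) (-1) t
    simp only [neg_one_mul] at h
    rw [← h, hμ]
  rw [charFun_neg] at h1
  rw [psi, sub_sub_cancel]
  exact (Complex.conj_eq_iff_re.1 h1).symm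

/-- The truncation inequality for a characteristic function with a power bound near zero. -/
theorem tail_le_of_norm_one_sub_charFun_le [IsProbabilityMeasure μ] {r M δ x : ℝ} (hr : 0 < r) (hM : 0 ≤ M) (hδ : 0 < δ)
    (h : ∀ t, |t| ≤ δ → ‖1 - charFun μ t‖ ≤ M * |t| ^ r) (hx : 4 / δ ≤ x) :
    tail μ x ≤ 2 * 4 ^ r * M * x ^ (-r) := by
  have hx0 : 0 < x := lt_of_lt_of_le (by positivity) hx
  have h4 : 4 / x ≤ δ := by
    rw [div_le_iff₀ hδ] at hx
    rw [div_le_iff₀ hx0]; linarith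
  have e : 2 * (x / 2)⁻¹ = 4 / x := by field_simp; norm_num
  -- Halving `x` makes the inequality strict and puts the integral over `|t| ≤ 4/x`, hence the
  -- condition `4/δ ≤ x`.
  have h1 : tail μ x ≤ μ.real {y | x / 2 < |y|} :=
    measureReal_mono fun y hy => lt_of_lt_of_le (by linarith) (show x ≤ |y| from hy)
  have h2 := measureReal_abs_gt_le_integral_charFun (μ := μ) (half_pos hx0)
  rw [neg_mul, e] at h2
  have h3 : ‖∫ t in (-(4 / x))..(4 / x), 1 - charFun μ t‖
      ≤ M * (4 / x) ^ r * |4 / x - -(4 / x)| := by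
    refine intervalIntegral.norm_integral_le_of_norm_le_const fun t ht => ?_
    have h0 : 0 < 4 / x := by positivity
    rw [Set.uIoc_of_le (by linarith)] at ht
    have hta : |t| ≤ 4 / x := abs_le.2 ⟨ht.1.le, ht.2⟩
    refine (h t (hta.trans h4)).trans (mul_le_mul_of_nonneg_left ?_ hM)
    exact Real.rpow_le_rpow (abs_nonneg _) hta hr.le
  have h5 : |4 / x - -(4 / x)| = 8 / x := by
    rw [abs_of_pos (by have : 0 < 4 / x := by positivity
                       linarith)]
    ring
  rw [h5] at h3
  refine (h1.trans h2).trans ((mul_le_mul_of_nonneg_left h3 (by positivity)).trans_eq ?_)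
  rw [Real.div_rpow (by norm_num) hx0.le, Real.rpow_neg hx0.le]
  field_simp
  ring

end Psi

/-! ### Normed sums and natural norming sequences. -/

section NormedSum

variable {Ω : Type*} [MeasurableSpace Ω] {P : Measure Ω} {ξ : ℕ → Ω → ℝ} {b : ℕ → ℝ}
  {μ : Measure ℝ}

theorem IsIIDSequence.aemeasurable_normedSum (h : IsIIDSequence P ξ μ) (n : ℕ) :
    AEMeasurable (normedSum ξ b n) P :=
  (Finset.aemeasurable_fun_sum _ fun k _ => (h.law k).aemeasurable).const_mul _

theorem IsIIDSequence.charFun_normedSum (h : IsIIDSequence P ξ μ) (n : ℕ) (t : ℝ) :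
    charFun (P.map (normedSum ξ b n)) t = charFun μ (t / b n) ^ n := by
  unfold normedSum
  rw [charFun_map_mul_comp (Finset.aemeasurable_fun_sum _ fun k _ => (h.law k).aemeasurable),
    (h.indep.restrict _).charFun_map_fun_finsetSum_eq_prod fun k _ => (h.law k).aemeasurable]
  simp [fun k => (h.law k).map_eq, div_eq_inv_mul]

theorem norm_one_sub_pow_le {z : ℂ} (hz : ‖z‖ ≤ 1) (n : ℕ) : ‖1 - z ^ n‖ ≤ n * ‖1 - z‖ := by
  induction n with
  | zero => simp
  | succ n ih =>
    have e : 1 - z ^ (n + 1) = (1 - z ^ n) + z ^ n * (1 - z) := by ring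
    have h : ‖z ^ n * (1 - z)‖ ≤ ‖1 - z‖ := by
      rw [norm_mul, norm_pow]
      exact mul_le_of_le_one_left (norm_nonneg _) (pow_le_one₀ (norm_nonneg _) hz)
    rw [e]; push_cast
    linarith [norm_add_le (1 - z ^ n) (z ^ n * (1 - z))]

theorem IsIIDSequence.tail_normedSum_le [IsProbabilityMeasure P] [IsProbabilityMeasure μ]
    (h : IsIIDSequence P ξ μ)
    (hre : ∀ t, charFun μ t = ((1 - psi μ t : ℝ) : ℂ)) (n : ℕ) {r M δ x : ℝ}
    (hr : 0 < r) (hM : 0 ≤ M) (hδ : 0 < δ)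
    (hψ : ∀ t, |t| ≤ δ → n * psi μ (t / b n) ≤ M * |t| ^ r) (hx : 4 / δ ≤ x) :
    tail (P.map (normedSum ξ b n)) x ≤ 2 * 4 ^ r * M * x ^ (-r) := by
  have := Measure.isProbabilityMeasure_map (h.aemeasurable_normedSum (b := b) n)
  refine tail_le_of_norm_one_sub_charFun_le hr hM hδ (fun t ht => ?_) hx
  rw [h.charFun_normedSum]
  refine (norm_one_sub_pow_le (norm_charFun_le_one _) n).trans (le_of_eq_of_le ?_ (hψ t ht))
  rw [hre, ← Complex.ofReal_one, ← Complex.ofReal_sub, sub_sub_cancel, Complex.norm_real,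
    Real.norm_of_nonneg (psi_nonneg _)]

theorem uniformTail_le {x K : ℝ} (h : ∀ n : ℕ+, tail (P.map (normedSum ξ b n)) x ≤ K) :
    uniformTail P ξ b x ≤ K := ciSup_le h

theorem IsIIDSequence.tail_le_uniformTail [IsProbabilityMeasure P] (h : IsIIDSequence P ξ μ) (n : ℕ+) (x : ℝ) :
    tail (P.map (normedSum ξ b n)) x ≤ uniformTail P ξ b x := by
  -- A real supremum is meaningful only for a bounded family; probabilities are at most 1.
  refine le_ciSup (f := fun n : ℕ+ => tail (P.map (normedSum ξ b n)) x) ⟨1, ?_⟩ n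
  rintro _ ⟨m, rfl⟩
  have := Measure.isProbabilityMeasure_map (h.aemeasurable_normedSum (b := b) m)
  exact measureReal_le_one

theorem IsIIDSequence.map_normedSum_one (h : IsIIDSequence P ξ μ) (hb : b 1 = 1) :
    P.map (normedSum ξ b 1) = μ := by
  rw [← (h.law 0).map_eq]
  congr 1 with ω
  simp [normedSum, hb]

/-- A natural norming sequence satisfies `n ψ(1 / b(n)) ≤ 2`, including at the indices where the
defining equation has no solution. -/
theorem IsNaturalNorming.mul_psi_le_two [IsProbabilityMeasure μ] (hb : IsNaturalNorming μ b) {n : ℕ} (hn : 1 ≤ n) :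
    n * psi μ (1 / b n) ≤ 2 := by
  rcases hn.eq_or_lt with rfl | hn
  -- No equation is imposed at `n = 1`; this case alone costs the constant 2.
  · simpa using psi_le_two _
  have hn0 : (0 : ℝ) < n := by positivity
  suffices h : psi μ (1 / b n) ≤ 1 / n by
    have := mul_le_mul_of_nonneg_left h hn0.le
    rw [mul_one_div_cancel hn0.ne'] at this
    linarith
  by_cases hs : ∃ s, 0 < s ∧ psi μ s = 1 / (n : ℝ)
  · exact (hb.eqn n hn hs).le
  -- As `ψ(0) = 0`, a value above `1/n` would produce a solution by the intermediate value theorem.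
  by_contra! hlt
  have hbn : 0 < 1 / b n := one_div_pos.2 (hb.pos n hn)
  obtain ⟨s, ⟨hs0, -⟩, hs1⟩ := intermediate_value_Icc hbn.le continuous_psi.continuousOn
    (show (1 / n : ℝ) ∈ Set.Icc (psi μ 0) (psi μ (1 / b n)) from
      ⟨by rw [psi_zero]; positivity, hlt.le⟩)
  refine hs ⟨s, hs0.lt_of_ne ?_, hs1⟩
  rintro rfl
  rw [psi_zero] at hs1
  exact (by positivity : (0 : ℝ) < 1 / n).ne hs1

theorem IsNaturalNorming.pos_of_one_le {μ : Measure ℝ} (hb : IsNaturalNorming μ b) {n : ℕ}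
    (hn : 1 ≤ n) : 0 < b n := by
  rcases hn.eq_or_lt with rfl | hn
  · rw [hb.one]; exact one_pos
  · exact hb.pos n hn

end NormedSum

/-! ### Logarithmic tails and the class `MI`. -/

section LogTail

/-- A crude bound suffices: eventually `L(2y) ≤ 2L(y)`, so a bound on the compact `[Y, 2Y]`
propagates dyadically. -/
theorem IsSlowlyVarying.exists_le_mul {L : ℝ → ℝ} (hL : IsSlowlyVarying L) :
    ∃ B Y : ℝ, 0 ≤ B ∧ 1 < Y ∧ ∀ y, Y ≤ y → L y ≤ B * y := by
  have h2 : ∀ᶠ y in atTop, L (2 * y) / L y < 2 :=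
    (hL.tendsto_ratio 2 two_pos).eventually_lt_const (by norm_num)
  obtain ⟨Y₀, hY₀⟩ := eventually_atTop.1 h2
  set Y := max Y₀ 2
  have hY2 : 2 ≤ Y := le_max_right _ _
  have hdouble : ∀ y, Y ≤ y → L (2 * y) ≤ 2 * L y := fun y hy =>
    ((div_lt_iff₀ (hL.pos y (by linarith))).1 (hY₀ y ((le_max_left _ _).trans hy))).le
  obtain ⟨B, hB⟩ := (isCompact_Icc (a := Y) (b := 2 * Y)).bddAbove_image
    (hL.continuousOn.mono fun y hy => show 1 < y by linarith [hy.1])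
  have hB' : ∀ y ∈ Set.Icc Y (2 * Y), L y ≤ B := fun y hy => hB (Set.mem_image_of_mem L hy)
  have hB0 : 0 ≤ B := (hL.pos Y (by linarith)).le.trans (hB' Y ⟨le_rfl, by linarith⟩)
  have key : ∀ k : ℕ, ∀ y, Y ≤ y → y ≤ 2 ^ (k + 1) * Y → L y ≤ B * y := by
    intro k
    induction k with
    | zero =>
      intro y h1 h3
      refine (hB' y ⟨h1, by simpa using h3⟩).trans (le_mul_of_one_le_right hB0 (by linarith))
    | succ k ih =>
      intro y h1 h3
      rcases le_total y (2 * Y) with h | h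
      · exact (hB' y ⟨h1, h⟩).trans (le_mul_of_one_le_right hB0 (by linarith))
      · have h4 := ih (y / 2) (by linarith) (by rw [pow_succ] at h3; linarith)
        have h5 := hdouble (y / 2) (by linarith)
        rw [mul_div_cancel₀ y two_ne_zero] at h5
        linarith
  refine ⟨B, Y, hB0, by linarith, fun y hy => ?_⟩
  obtain ⟨k, hk⟩ := pow_unbounded_of_one_lt y (one_lt_two (α := ℝ))
  refine key k y hy (hk.le.trans ?_)
  have : (0 : ℝ) < 2 ^ k := by positivity
  rw [pow_succ]; nlinarith

variable {μ : Measure ℝ} {r γ : ℝ} {L : ℝ → ℝ}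

/-- With `y = log x` the product is at most `B y^(γ+1) e^{-(r-p)y}`. -/
theorem HasLogTail.tendsto_rpow_mul_tail (h : HasLogTail μ r γ L) (hL : IsSlowlyVarying L)
    {p : ℝ} (hp : p < r) : Tendsto (fun x => x ^ p * tail μ x) atTop (𝓝 0) := by
  obtain ⟨B, Y, hB0, hY, hB⟩ := hL.exists_le_mul
  have hlim := ((tendsto_rpow_mul_exp_neg_mul_atTop_nhds_zero (γ + 1) (r - p)
    (sub_pos.2 hp)).comp Real.tendsto_log_atTop).const_mul B
  rw [mul_zero] at hlim
  refine tendsto_of_tendsto_of_tendsto_of_le_of_le' tendsto_const_nhds hlim ?_ ?_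
  · filter_upwards [eventually_gt_atTop 0] with x hx
    exact mul_nonneg (Real.rpow_nonneg hx.le _) (tail_nonneg _)
  · filter_upwards [eventually_gt_atTop (Real.exp 1),
      Real.tendsto_log_atTop.eventually_ge_atTop Y] with x hx hxY
    have hx0 : 0 < x := (Real.exp_pos 1).trans hx
    have hl : 0 < Real.log x := by linarith
    have e1 : Real.exp (-(r - p) * Real.log x) = x ^ p * x ^ (-r) := by
      rw [← Real.rpow_add hx0, Real.rpow_def_of_pos hx0]; congr 1; ring
    rw [h x hx]
    simp only [Function.comp_apply]
    rw [e1, Real.rpow_add_one hl.ne']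
    calc x ^ p * (x ^ (-r) * Real.log x ^ γ * L (Real.log x))
        = (x ^ p * x ^ (-r) * Real.log x ^ γ) * L (Real.log x) := by ring
      _ ≤ (x ^ p * x ^ (-r) * Real.log x ^ γ) * (B * Real.log x) :=
          mul_le_mul_of_nonneg_left (hB _ hxY) (by positivity)
      _ = _ := by ring

theorem HasLogTail.continuousOn (h : HasLogTail μ r γ L) (hL : IsSlowlyVarying L) :
    ContinuousOn (tail μ) (Set.Ioi (Real.exp 1)) := by
  have hlog : ∀ x ∈ Set.Ioi (Real.exp 1), 1 < Real.log x := fun x hx =>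
    (Real.lt_log_iff_exp_lt ((Real.exp_pos 1).trans hx)).2 hx
  have hx0 : ∀ x ∈ Set.Ioi (Real.exp 1), x ≠ 0 := fun x hx => ((Real.exp_pos 1).trans hx).ne'
  have hc : ContinuousOn Real.log (Set.Ioi (Real.exp 1)) :=
    Real.continuousOn_log.mono fun x hx => hx0 x hx
  refine ContinuousOn.congr ?_ h
  refine ((continuousOn_id.rpow_const fun x hx => Or.inl (hx0 x hx)).mul
    (hc.rpow_const fun x hx => Or.inl (by linarith [hlog x hx]))).mul ?_
  exact hL.continuousOn.comp hc hlog

theorem HasLogTail.measure_singleton_eq_zero [IsProbabilityMeasure μ] (h : HasLogTail μ r γ L)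
    (hL : IsSlowlyVarying L) {y : ℝ} (hy : Real.exp 1 < |y|) : μ {y} = 0 := by
  have hlt : ∀ z, |y| < z → μ.real {y} ≤ tail μ |y| - tail μ z := by
    intro z hz
    have hd : Disjoint {y} {w : ℝ | z ≤ |w|} := by
      rw [Set.disjoint_singleton_left]; exact not_le.2 hz
    have := measureReal_union (μ := μ) hd (measurableSet_le_abs z)
    have h2 : μ.real ({y} ∪ {w : ℝ | z ≤ |w|}) ≤ tail μ |y| := by
      refine measureReal_mono (Set.union_subset ?_ fun w hw => ?_)
      · simp
      · exact hz.le.trans hw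
    unfold tail at *
    linarith
  have hcont : Tendsto (fun z => tail μ |y| - tail μ z) (𝓝[>] |y|) (𝓝 (tail μ |y| - tail μ |y|)) :=
    tendsto_const_nhds.sub (((h.continuousOn hL).continuousAt
      (Ioi_mem_nhds hy)).tendsto.mono_left nhdsWithin_le_nhds)
  rw [sub_self] at hcont
  have : μ.real {y} ≤ 0 := ge_of_tendsto hcont (eventually_mem_nhdsWithin.mono fun z hz => hlt z hz)
  exact (measureReal_eq_zero_iff).1 (le_antisymm this measureReal_nonneg)

/-- A law with a continuous positive tail is not a lattice law. -/
theorem HasLogTail.psi_pos [IsProbabilityMeasure μ] (h : HasLogTail μ r γ L)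
    (hL : IsSlowlyVarying L) {s : ℝ} (hs : s ≠ 0) : 0 < psi μ s := by
  refine (psi_nonneg s).lt_of_ne fun h0 => ?_
  rw [psi_eq_integral, eq_comm, integral_eq_zero_iff_of_nonneg
    (fun x => sub_nonneg.2 (Real.cos_le_one _)) (integrable_one_sub_cos s)] at h0
  -- If `ψ(s) = 0`, the law lives on this countable set; having no atoms beyond `e`, it would have
  -- zero tail there.
  set A : Set ℝ := {x | Real.cos (s * x) = 1}
  have hA : μ Aᶜ = 0 := by
    rw [← mem_ae_iff]
    filter_upwards [h0] with x hx
    exact (sub_eq_zero.1 hx).symm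
  have hAc : A.Countable := by
    refine (Set.countable_range fun n : ℤ => (n * (2 * Real.pi)) / s).mono fun x hx => ?_
    obtain ⟨n, hn⟩ := (Real.cos_eq_one_iff _).1 hx
    exact ⟨n, by simp only [hn]; field_simp⟩
  set x : ℝ := Real.exp 1 + 1
  have hx : Real.exp 1 < x := lt_add_one _
  have hz : μ (A ∩ {y | x ≤ |y|}) = 0 := by
    refine (measure_null_iff_singleton (hAc.mono Set.inter_subset_left)).2 fun y hy => ?_
    exact h.measure_singleton_eq_zero hL (hx.trans_le hy.2)
  have ht : tail μ x = 0 := by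
    refine (measureReal_eq_zero_iff).2 (measure_mono_null (fun y hy => ?_)
      (measure_union_null hA hz))
    by_cases hyA : y ∈ A
    · exact Or.inr ⟨hyA, hy⟩
    · exact Or.inl hyA
  have hx0 : 0 < x := (Real.exp_pos 1).trans hx
  have hlog : 1 < Real.log x := (Real.lt_log_iff_exp_lt hx0).2 hx
  have hL0 := hL.pos _ hlog
  have hl0 : 0 < Real.log x := by linarith
  rw [h x hx] at ht
  exact (by positivity : 0 < x ^ (-r) * Real.log x ^ γ * L (Real.log x)).ne' ht

/-- In the class `MI` the quotient `ψ(λt)/ψ(λ)` is bounded by its limit `t ^ r` at `λ = 0`. -/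
theorem HasLogTail.psi_mul_le_of_lt_one [IsProbabilityMeasure μ] (h : HasLogTail μ r γ L)
    (hL : IsSlowlyVarying L) {t l : ℝ} (ht0 : 0 < t) (ht1 : t < 1)
    (htr : Real.pi ^ 2 / 4 * t ^ 2 ≤ t ^ r)
    (hanti : AntitoneOn (fun l => psi μ (l * t) / psi μ l) (Set.Ioo 0 1))
    (hl : l ∈ Set.Ioo (0 : ℝ) 1) : psi μ (l * t) ≤ t ^ r * psi μ l := by
  have hψ : ∀ s, 0 < s → 0 < psi μ s := fun s hs => h.psi_pos hL hs.ne'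
  rw [← div_le_iff₀ (hψ l hl.1)]
  by_contra! hlt
  set q := psi μ (l * t) / psi μ l
  have hq0 : 0 < q := (Real.rpow_pos_of_pos ht0 r).trans hlt
  have hstep : ∀ s, 0 < s → s ≤ l → q * psi μ s ≤ psi μ (s * t) := fun s hs hsl => by
    rw [← le_div_iff₀ (hψ s hs)]
    exact hanti ⟨hs, hsl.trans_lt hl.2⟩ hl hsl
  have hlk : ∀ k : ℕ, 0 < l * t ^ k := fun k => mul_pos hl.1 (pow_pos ht0 k)
  have hpow : ∀ k : ℕ, q ^ k * psi μ l ≤ psi μ (l * t ^ k) := by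
    intro k
    induction k with
    | zero => simp
    | succ k ih =>
      have h1 := hstep (l * t ^ k) (hlk k)
        (mul_le_of_le_one_right hl.1.le (pow_le_one₀ ht0.le ht1.le))
      rw [pow_succ, pow_succ, ← mul_assoc]
      exact le_trans (by nlinarith) h1
  -- Truncation at `B = 1/(l t^k)`: as `q > π²t²/4`, the quadratic term cannot account for `ψ(l
  -- t^(k+1))`, so the tail must.
  have htail : ∀ k : ℕ, (q - Real.pi ^ 2 / 4 * t ^ 2) * psi μ l * q ^ k
      ≤ 2 * tail μ (1 / (l * t ^ k)) := by
    intro k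
    have h1 := psi_le_mul_psi_add_tail (μ := μ) (l * t ^ k * t) (one_div_pos.2 (hlk k))
    have e1 : l * t ^ k * t * (1 / (l * t ^ k)) = t := by
      rw [mul_right_comm, mul_one_div_cancel (hlk k).ne', one_mul]
    rw [e1, one_div_one_div] at h1
    have h2 := hstep (l * t ^ k) (hlk k)
        (mul_le_of_le_one_right hl.1.le (pow_le_one₀ ht0.le ht1.le))
    have h3 := mul_le_mul_of_nonneg_left (hpow k)
      (show 0 ≤ q - Real.pi ^ 2 / 4 * t ^ 2 by linarith)
    linarith
  have hlogt : Real.log t < 0 := Real.log_neg ht0 ht1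
  set p := Real.log q / Real.log t
  have hqp : q = t ^ p := by
    rw [Real.rpow_def_of_pos ht0, mul_div_cancel₀ _ hlogt.ne, Real.exp_log hq0]
  have hpr : p < r := (Real.rpow_lt_rpow_left_iff_of_base_lt_one ht0 ht1).1 (hqp ▸ hlt)
  have hy : Tendsto (fun k : ℕ => 1 / (l * t ^ k)) atTop atTop := by
    have : Tendsto (fun k : ℕ => l⁻¹ * (t⁻¹) ^ k) atTop atTop :=
      (tendsto_pow_atTop_atTop_of_one_lt ((one_lt_inv₀ ht0).2 ht1)).const_mul_atTop
        (inv_pos.2 hl.1)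
    refine this.congr fun k => ?_
    rw [one_div, mul_inv, inv_pow]
  have hlim := (h.tendsto_rpow_mul_tail hL hpr).comp hy
  have hc : 0 < (q - Real.pi ^ 2 / 4 * t ^ 2) * psi μ l * (1 / l) ^ p / 2 := by
    have := hψ l hl.1
    have h1 : 0 < q - Real.pi ^ 2 / 4 * t ^ 2 := by linarith
    have := Real.rpow_pos_of_pos (one_div_pos.2 hl.1) p
    positivity
  refine hc.not_ge (ge_of_tendsto' hlim fun k => ?_)
  simp only [Function.comp_apply]
  -- With `q = t^p` the dependence on `k` cancels, leaving a positive lower bound for a null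
  -- sequence.
  have e2 : (1 / (l * t ^ k)) ^ p * q ^ k = (1 / l) ^ p := by
    rw [hqp, ← Real.rpow_mul_natCast ht0.le, mul_comm p, Real.rpow_natCast_mul ht0.le,
      ← Real.mul_rpow (one_div_pos.2 (hlk k)).le (pow_pos ht0 k).le]
    congr 1
    have := (pow_pos ht0 k).ne'
    have := hl.1.ne'
    field_simp
  have h4 := mul_le_mul_of_nonneg_left (htail k)
    (Real.rpow_nonneg (one_div_pos.2 (hlk k)).le p)
  rw [← e2]
  linarith

end LogTail

theorem mul_sq_le_rpow {r K t : ℝ} (hr : r < 2) (hK : 0 < K) (ht : 0 < t)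
    (htK : t ≤ (1 / K) ^ (1 / (2 - r))) : K * t ^ 2 ≤ t ^ r := by
  have h2r : 0 < 2 - r := by linarith
  have h1 : t ^ (2 - r) ≤ 1 / K := by
    refine (Real.rpow_le_rpow ht.le htK h2r.le).trans_eq ?_
    rw [← Real.rpow_mul (by positivity), one_div_mul_cancel h2r.ne', Real.rpow_one]
  have e : t ^ 2 = t ^ r * t ^ (2 - r) := by
    rw [← Real.rpow_add ht, add_sub_cancel, Real.rpow_two]
  have h3 : 0 < t ^ r := Real.rpow_pos_of_pos ht r
  calc K * t ^ 2 = t ^ r * (K * t ^ (2 - r)) := by rw [e]; ring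
    _ ≤ t ^ r * (K * (1 / K)) := by gcongr
    _ = t ^ r := by rw [mul_one_div_cancel hK.ne', mul_one]

theorem HasLogTail.exists_psi_mul_le {μ : Measure ℝ} [IsProbabilityMeasure μ] {r γ : ℝ}
    {L : ℝ → ℝ} (h : HasLogTail μ r γ L) (hL : IsSlowlyVarying L) (hr : 0 < r) (hr2 : r < 2)
    (hMI : ClassMI μ) :
    ∃ δ : ℝ, 0 < δ ∧ ∀ l, 0 < l → l ≤ 1 → ∀ t, |t| ≤ δ → psi μ (l * t) ≤ |t| ^ r * psi μ l := by
  obtain ⟨Δ, hΔ, hanti⟩ := hMI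
  set m : ℝ := (1 / (Real.pi ^ 2 / 4)) ^ (1 / (2 - r))
  have hm : 0 < m := by
    have := Real.pi_pos
    positivity
  -- The three terms ensure `|t| < Δ`, `|t| < 1` and `π²t²/4 ≤ |t|^r`; the last needs `r < 2`.
  refine ⟨min (Δ / 2) (min (1 / 2) m), by positivity, fun l hl0 hl1 t ht => ?_⟩
  have htΔ : |t| < Δ := by linarith [ht.trans (min_le_left _ _)]
  have ht2 := ht.trans (min_le_right _ _)
  have ht1 : |t| < 1 := by linarith [ht2.trans (min_le_left _ _)]
  have htm : |t| ≤ m := ht2.trans (min_le_right _ _)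
  rcases eq_or_ne t 0 with rfl | ht0
  · simp [psi_zero, Real.zero_rpow hr.ne']
  have hta : 0 < |t| := abs_pos.2 ht0
  have key : ∀ l ∈ Set.Ioo (0 : ℝ) 1, psi μ (l * |t|) ≤ |t| ^ r * psi μ l := fun l hl =>
    h.psi_mul_le_of_lt_one hL hta ht1
      (mul_sq_le_rpow hr2 (by have := Real.pi_pos; positivity) hta htm)
      (hanti |t| ⟨hta.le, htΔ⟩) hl
  rw [← psi_abs, abs_mul, abs_of_pos hl0]
  -- `MI` omits `l = 1`; continuity of `ψ` supplies it.
  refine (le_on_closure (s := Set.Ioo (0 : ℝ) 1) key ?_ ?_) ?_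
  · exact (continuous_psi.comp (continuous_id.mul continuous_const)).continuousOn
  · exact (continuous_const.mul continuous_psi).continuousOn
  · rw [closure_Ioo one_pos.ne]
    exact ⟨hl0.le, hl1⟩

/-! ### Uniform upper bounds. -/

section UpperBound

variable {Ω : Type*} [MeasurableSpace Ω] {P : Measure Ω} [IsProbabilityMeasure P]
  {ξ : ℕ → Ω → ℝ} {b : ℕ → ℝ} {μ : Measure ℝ} [IsProbabilityMeasure μ] {r δ : ℝ}

theorem tail_normedSum_le_of_one_le (h : IsIIDSequence P ξ μ) (hμ : SymmetricLaw μ)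
    (hb : IsNaturalNorming μ b) (hr : 0 < r) (hδ : 0 < δ)
    (hψ : ∀ l, 0 < l → l ≤ 1 → ∀ t, |t| ≤ δ → psi μ (l * t) ≤ |t| ^ r * psi μ l)
    {n : ℕ} (hn : 1 ≤ n) (hbn : 1 ≤ b n) {x : ℝ} (hx : 4 / δ ≤ x) :
    tail (P.map (normedSum ξ b n)) x ≤ 2 * 4 ^ r * 2 * x ^ (-r) := by
  have hb0 : 0 < b n := one_pos.trans_le hbn
  refine h.tail_normedSum_le (charFun_eq_one_sub_psi hμ) n hr two_pos.le hδ (fun t ht => ?_) hx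
  have h1 := hψ (1 / b n) (one_div_pos.2 hb0) ((div_le_one hb0).2 hbn) t ht
  rw [one_div_mul_eq_div] at h1
  have h2 := hb.mul_psi_le_two hn
  have h3 : 0 ≤ |t| ^ r := by positivity
  calc n * psi μ (t / b n) ≤ n * (|t| ^ r * psi μ (1 / b n)) := by gcongr
    _ = n * psi μ (1 / b n) * |t| ^ r := by ring
    _ ≤ 2 * |t| ^ r := by gcongr

/-- Covers `b n < 1`, where `1/b n` is no admissible scale: `l = 1` is used instead, at the price of
constants depending on `n`. -/
theorem exists_tail_normedSum_le (h : IsIIDSequence P ξ μ) (hμ : SymmetricLaw μ)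
    (hb : IsNaturalNorming μ b) (hr : 0 < r) (hδ : 0 < δ)
    (hψ : ∀ l, 0 < l → l ≤ 1 → ∀ t, |t| ≤ δ → psi μ (l * t) ≤ |t| ^ r * psi μ l)
    {n : ℕ} (hn : 1 ≤ n) :
    ∃ K X : ℝ, 0 ≤ K ∧ 0 ≤ X ∧
      ∀ x, X ≤ x → tail (P.map (normedSum ξ b n)) x ≤ K * x ^ (-r) := by
  have hb0 : 0 < b n := hb.pos_of_one_le hn
  have hM : 0 ≤ n * psi μ 1 / b n ^ r :=
    div_nonneg (mul_nonneg (by positivity) (psi_nonneg 1)) (by positivity)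
  refine ⟨2 * 4 ^ r * (n * psi μ 1 / b n ^ r), 4 / (δ * b n), by positivity, by positivity,
    fun x hx => ?_⟩
  refine h.tail_normedSum_le (charFun_eq_one_sub_psi hμ) n hr hM (by positivity)
    (fun t ht => ?_) hx
  have hta : |t / b n| = |t| / b n := by rw [abs_div, abs_of_pos hb0]
  have h1 := hψ 1 one_pos le_rfl (t / b n) (by rwa [hta, div_le_iff₀ hb0])
  rw [one_mul, hta, Real.div_rpow (abs_nonneg t) hb0.le] at h1
  calc n * psi μ (t / b n) ≤ n * (|t| ^ r / b n ^ r * psi μ 1) := by gcongr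
    _ = _ := by ring

theorem exists_uniformTail_le (h : IsIIDSequence P ξ μ) (hμ : SymmetricLaw μ)
    (hb : IsNaturalNorming μ b) (hr : 0 < r) (hδ : 0 < δ)
    (hψ : ∀ l, 0 < l → l ≤ 1 → ∀ t, |t| ≤ δ → psi μ (l * t) ≤ |t| ^ r * psi μ l) :
    ∃ K X : ℝ, 0 < K ∧ 0 ≤ X ∧ ∀ x, X ≤ x → uniformTail P ξ b x ≤ K * x ^ (-r) := by
  obtain ⟨N, hN⟩ := eventually_atTop.1 (hb.tendsto.eventually_ge_atTop 1)
  choose K X hK hX hKX using fun n : ℕ =>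
    exists_tail_normedSum_le h hμ hb hr hδ hψ (Nat.le_add_left 1 n)
  have hKs : 0 ≤ ∑ i ∈ Finset.range N, K i := Finset.sum_nonneg fun i _ => hK i
  have hXs : 0 ≤ ∑ i ∈ Finset.range N, X i := Finset.sum_nonneg fun i _ => hX i
  have hC : (0 : ℝ) < 2 * 4 ^ r * 2 := by positivity
  have hδ4 : 0 < 4 / δ := by positivity
  -- Only finitely many `n` have `b n < 1`; sums of nonnegative terms dominate each of their
  -- constants.
  refine ⟨2 * 4 ^ r * 2 + ∑ i ∈ Finset.range N, K i, 4 / δ + ∑ i ∈ Finset.range N, X i,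
    by positivity, by positivity, fun x hx => uniformTail_le fun n => ?_⟩
  have hx0 : 0 ≤ x ^ (-r) := Real.rpow_nonneg (by linarith) _
  rcases le_or_gt N n with hn | hn
  · refine (tail_normedSum_le_of_one_le h hμ hb hr hδ hψ n.2 (hN n hn) (by linarith)).trans ?_
    exact mul_le_mul_of_nonneg_right (by linarith) hx0
  · obtain ⟨m, hm⟩ : ∃ m, (n : ℕ) = m + 1 := Nat.exists_eq_add_of_le' n.2
    have hmN : m ∈ Finset.range N := Finset.mem_range.2 (by omega)
    have h1 := Finset.single_le_sum (fun i _ => hX i) hmN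
    have h2 := Finset.single_le_sum (fun i _ => hK i) hmN
    have h3 := hKX m x (by linarith)
    rw [← hm] at h3
    exact h3.trans (mul_le_mul_of_nonneg_right (by linarith) hx0)

end UpperBound

/-! ### The symmetric stable law. -/

section Stable

variable {μ : Measure ℝ} {r : ℝ}

theorem IsSymmetricStable.psi_eq (h : IsSymmetricStable μ r) (t : ℝ) :
    psi μ t = 1 - Real.exp (-(|t| ^ r)) := by
  rw [psi, h t, Complex.ofReal_re]

theorem IsSymmetricStable.psi_le (h : IsSymmetricStable μ r) (t : ℝ) : psi μ t ≤ |t| ^ r := by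
  rw [h.psi_eq]
  linarith [Real.add_one_le_exp (-(|t| ^ r))]

theorem IsSymmetricStable.le_psi (h : IsSymmetricStable μ r) (hr : 0 < r) {t : ℝ}
    (ht0 : 0 < t) (ht1 : t ≤ 1) : t ^ r / 2 ≤ psi μ t := by
  rw [h.psi_eq, abs_of_pos ht0]
  have h0 : 0 < t ^ r := Real.rpow_pos_of_pos ht0 r
  have h1 : t ^ r ≤ 1 := Real.rpow_le_one ht0.le ht1 hr.le
  have h2 : Real.exp (-(t ^ r)) ≤ (1 + t ^ r)⁻¹ := by
    rw [Real.exp_neg]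
    exact inv_anti₀ (by linarith) (by linarith [Real.add_one_le_exp (t ^ r)])
  have h3 : (1 + t ^ r)⁻¹ ≤ 1 - t ^ r / 2 := by
    rw [inv_le_iff_one_le_mul₀ (by linarith)]
    nlinarith
  linarith

theorem IsSymmetricStable.charFun_eq (h : IsSymmetricStable μ r) (t : ℝ) :
    charFun μ t = ((1 - psi μ t : ℝ) : ℂ) := by
  rw [h.psi_eq, sub_sub_cancel, h t]

/-- For `n ≥ 2`, `u = (1/b n)^r` equals `-log(1 - 1/n) ≤ 1/(n-1)`, so `nu ≤ n/(n-1) ≤ 2`. -/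
theorem IsSymmetricStable.mul_rpow_le_two (h : IsSymmetricStable μ r) (hr : 0 < r) {b : ℕ → ℝ}
    (hb : IsNaturalNorming μ b) {n : ℕ} (hn : 1 ≤ n) : n * (1 / b n) ^ r ≤ 2 := by
  rcases hn.eq_or_lt with rfl | hn
  · simp [hb.one]
  have hn2 : (2 : ℝ) ≤ n := by exact_mod_cast hn
  have h0 : 0 < 1 - 1 / (n : ℝ) := by
    rw [sub_pos, div_lt_one (by linarith)]; linarith
  have h1 : 1 - 1 / (n : ℝ) < 1 := by
    have : 0 < 1 / (n : ℝ) := by positivity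
    linarith
  have hlog := Real.log_neg h0 h1
  have hsol : ∃ s, 0 < s ∧ psi μ s = 1 / (n : ℝ) := by
    have hs : 0 < (-Real.log (1 - 1 / (n : ℝ))) ^ (1 / r) := Real.rpow_pos_of_pos (by linarith) _
    refine ⟨_, hs, ?_⟩
    rw [h.psi_eq, abs_of_pos hs, ← Real.rpow_mul (by linarith), one_div_mul_cancel hr.ne',
      Real.rpow_one, neg_neg, Real.exp_log h0]
    ring
  have heq := hb.eqn n hn hsol
  have hbn : 0 < 1 / b n := one_div_pos.2 (hb.pos n hn)
  rw [h.psi_eq, abs_of_pos hbn] at heq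
  set u := (1 / b n) ^ r
  have hu : Real.exp (-u) = 1 - 1 / (n : ℝ) := by linarith
  have hu0 : 0 ≤ u := by positivity
  have h3 : (1 - 1 / (n : ℝ)) * (u + 1) ≤ 1 := by
    have e : Real.exp (-u) * Real.exp u = 1 := by rw [← Real.exp_add, neg_add_cancel, Real.exp_zero]
    rw [← hu]
    refine le_of_le_of_eq ?_ e
    exact mul_le_mul_of_nonneg_left (Real.add_one_le_exp u) (Real.exp_pos _).le
  have h4 : (n - 1) * (u + 1) ≤ n := by
    have := mul_le_mul_of_nonneg_left h3 (show (0 : ℝ) ≤ n by linarith)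
    rwa [← mul_assoc, mul_sub, mul_one_div_cancel (by linarith), mul_one] at this
  nlinarith

/-- In the truncation bound at `t = m/x`, `B = x`, the left side is at least `m^r x^{-r}/2` and the
quadratic term at most half of that; the tail supplies the rest. -/
theorem IsSymmetricStable.le_tail [IsProbabilityMeasure μ] (h : IsSymmetricStable μ r) (hr : 0 < r)
    {m : ℝ} (hm0 : 0 < m) (hm1 : m ≤ 1) (hm : Real.pi ^ 2 * m ^ 2 ≤ m ^ r) {x : ℝ} (hx : 1 ≤ x) :
    m ^ r / 8 * x ^ (-r) ≤ tail μ x := by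
  have hx0 : 0 < x := by linarith
  have h1 := h.le_psi hr (div_pos hm0 hx0) ((div_le_one hx0).2 (hm1.trans hx))
  have h2 := psi_le_mul_psi_add_tail (μ := μ) (m / x) hx0
  have h3 := h.psi_le (1 / x)
  rw [abs_of_pos (one_div_pos.2 hx0), one_div, Real.inv_rpow hx0.le, ← Real.rpow_neg hx0.le] at h3
  rw [div_mul_cancel₀ m hx0.ne', one_div] at h2
  rw [Real.div_rpow hm0.le hx0.le, div_eq_mul_inv (m ^ r), ← Real.rpow_neg hx0.le] at h1
  have h4 : 0 < x ^ (-r) := Real.rpow_pos_of_pos hx0 _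
  have h5 : Real.pi ^ 2 / 4 * m ^ 2 * psi μ x⁻¹ ≤ Real.pi ^ 2 / 4 * m ^ 2 * x ^ (-r) :=
    mul_le_mul_of_nonneg_left h3 (by positivity)
  have h6 := mul_le_mul_of_nonneg_right hm h4.le
  linarith

theorem IsSymmetricStable.uniformTail_le [IsProbabilityMeasure μ] (h : IsSymmetricStable μ r)
    (hr : 0 < r) {Ω : Type*} [MeasurableSpace Ω] {P : Measure Ω} [IsProbabilityMeasure P]
    {ξ : ℕ → Ω → ℝ} {b : ℕ → ℝ} (hξ : IsIIDSequence P ξ μ) (hb : IsNaturalNorming μ b)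
    {x : ℝ} (hx : 1 ≤ x) : uniformTail P ξ b x ≤ 2 * 4 ^ r * 2 * x ^ (-r) := by
  refine _root_.uniformTail_le fun n => ?_
  -- The bound on `ψ` holds for all `t`, so `δ` is free; `δ = 4` turns `4/δ ≤ x` into `1 ≤ x`.
  refine hξ.tail_normedSum_le h.charFun_eq n hr two_pos.le four_pos (fun t _ => ?_)
    (by simpa using hx)
  have h1 := h.psi_le (t / b n)
  have h2 := h.mul_rpow_le_two hr hb n.2
  have hbn : 0 < 1 / b n := one_div_pos.2 (hb.pos_of_one_le n.2)
  rw [div_eq_mul_one_div, abs_mul, abs_of_pos hbn, Real.mul_rpow (abs_nonneg t) hbn.le] at h1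
  have h3 : 0 ≤ |t| ^ r := by positivity
  rw [div_eq_mul_one_div]
  calc (n : ℝ) * psi μ (t * (1 / b n)) ≤ n * (|t| ^ r * (1 / b n) ^ r) := by gcongr
    _ = n * (1 / b n) ^ r * |t| ^ r := by ring
    _ ≤ 2 * |t| ^ r := mul_le_mul_of_nonneg_right h2 h3

end Stable

theorem theorem2p4 (r : ℝ) (hr0 : 0 < r) (hr2 : r < 2) :
    (∀ L : ℝ → ℝ, IsSlowlyVarying L →
      ∃ C : ℝ, 0 < C ∧
        ∀ (γ : ℝ) (μ : Measure ℝ) [IsProbabilityMeasure μ],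
          SymmetricLaw μ → HasLogTail μ r γ L → ClassRT μ → ClassMI μ →
          ∀ {Ω : Type*} [MeasurableSpace Ω] (P : Measure Ω) [IsProbabilityMeasure P]
            (ξ : ℕ → Ω → ℝ) (b : ℕ → ℝ),
            IsIIDSequence P ξ μ → IsNaturalNorming μ b →
            ∃ C' x₀ : ℝ, 0 < C' ∧ 1 < x₀ ∧ ∀ x, x₀ < x →
              uniformTail P ξ b x ≤ C' * x ^ (-r) ∧
              (∀ n : ℕ+, 1 ≤ b n → tail (P.map (normedSum ξ b n)) x ≤ C * x ^ (-r)) ∧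
              ((∀ n : ℕ+, 1 ≤ b n) → uniformTail P ξ b x ≤ C * x ^ (-r))) ∧
    (∃ c C x₀ : ℝ, 0 < c ∧ 0 < C ∧ 1 < x₀ ∧
      ∀ (μ : Measure ℝ) [IsProbabilityMeasure μ], IsSymmetricStable μ r →
        ∀ {Ω : Type*} [MeasurableSpace Ω] (P : Measure Ω) [IsProbabilityMeasure P]
          (ξ : ℕ → Ω → ℝ) (b : ℕ → ℝ),
          IsIIDSequence P ξ μ → IsNaturalNorming μ b →
          ∀ x, x₀ < x → c * x ^ (-r) ≤ uniformTail P ξ b x ∧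
            uniformTail P ξ b x ≤ C * x ^ (-r)) := by
  refine ⟨fun L hL => ⟨2 * 4 ^ r * 2, by positivity, ?_⟩, ?_⟩
  · intro γ μ _ hμ hT _ hMI Ω _ P _ ξ b hξ hb
    obtain ⟨δ, hδ, hψ⟩ := hT.exists_psi_mul_le hL hr0 hr2 hMI
    obtain ⟨K, X, hK, hX, hU⟩ := exists_uniformTail_le hξ hμ hb hr0 hδ hψ
    have hδ4 : 0 < 4 / δ := by positivity
    refine ⟨K, 2 + X + 4 / δ, hK, by linarith, fun x hx => ?_⟩
    have hone : ∀ n : ℕ+, 1 ≤ b n →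
        tail (P.map (normedSum ξ b n)) x ≤ 2 * 4 ^ r * 2 * x ^ (-r) := fun n hn =>
      tail_normedSum_le_of_one_le hξ hμ hb hr0 hδ hψ n.2 hn (by linarith)
    exact ⟨hU x (by linarith), hone, fun hb1 => uniformTail_le fun n => hone n (hb1 n)⟩
  · have hpi := Real.pi_pos
    set m : ℝ := min 1 ((1 / Real.pi ^ 2) ^ (1 / (2 - r)))
    have hm0 : 0 < m := lt_min one_pos (by positivity)
    have hm := mul_sq_le_rpow hr2 (by positivity : 0 < Real.pi ^ 2) hm0 (min_le_right _ _)
    refine ⟨m ^ r / 8, 2 * 4 ^ r * 2, 2, by positivity, by positivity, one_lt_two, ?_⟩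
    intro μ _ hμ Ω _ P _ ξ b hξ hb x hx
    refine ⟨?_, hμ.uniformTail_le hr0 hξ hb (by linarith)⟩
    have h1 := hξ.tail_le_uniformTail (b := b) 1 x
    rw [PNat.one_coe, hξ.map_normedSum_one hb.one] at h1
    exact (hμ.le_tail hr0 hm0 (min_le_left _ _) hm (by linarith)).trans h1
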